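/- Let $\Omega\subset\mathbb{C}$ be a simply connected domain, and let $H(\Omega)$ be the space of holomorphic functions on $\Omega$ with the topology of uniform convergence on compact subsets of $\Omega$. For $N\ge 0$ let $\widetilde{T}_N:H(\Omega)\to H(\Omega)$ be the operator $$\widetilde{T}_N(f)(\zeta)=\sum_{n=0}^{N}\frac{f^{(n)}(\zeta)}{n!}(-\zeta)^n,\qquad \zeta\in\Omega,$$ that is, the $N$-th partial sum at the point $0$ of the Taylor expansion of $f$ with center $\zeta$. Let $\widetilde{S}(\Omega)$ be the set of all $f\in H(\Omega)$ such that the set $\{\widetilde{T}_N(f):N\ge 0\}$ is dense in $H(\Omega)$. Then either $\widetilde{S}(\Omega)=\emptyset$ or $\widetilde{S}(\Omega)$ is a dense $G_\delta$ set in $H(\Omega)$. -/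

import Mathlib

open TopologicalSpace

namespace TaylorCenter

/-- The extension by zero to the plane of a function on the open set `Ω`. It is only a device for
speaking of complex derivatives at points of `Ω`, where these do not depend on the extension. -/
noncomputable def extendZero {Ω : Opens ℂ} (f : Ω → ℂ) : ℂ → ℂ :=
  Function.extend Subtype.val f 0

theorem extendZero_apply {Ω : Opens ℂ} (f : Ω → ℂ) (z : Ω) : extendZero f z = f z :=
  Subtype.val_injective.extend_apply f 0 z

/-- The space `H(Ω)` of holomorphic functions on the open set `Ω`, as a linear subspace of the
space of continuous functions `C(Ω, ℂ)`. Its topology is the subspace topology of Mathlib's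
compact-open topology, that is, the topology of uniform convergence on compact subsets of `Ω`. -/
noncomputable def Holo (Ω : Opens ℂ) : Submodule ℂ C(Ω, ℂ) where
  carrier := {f | DifferentiableOn ℂ (extendZero f) Ω}
  zero_mem' := (differentiableOn_const (0 : ℂ)).congr fun z hz =>
    extendZero_apply (⇑(0 : C(Ω, ℂ))) ⟨z, hz⟩
  add_mem' {f g} hf hg := (hf.add hg).congr fun z hz => by
    have h1 := extendZero_apply (⇑(f + g)) ⟨z, hz⟩
    have h2 := extendZero_apply (⇑f) ⟨z, hz⟩
    have h3 := extendZero_apply (⇑g) ⟨z, hz⟩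
    simp_all
  smul_mem' c f hf := (hf.const_smul c).congr fun z hz => by
    have h1 := extendZero_apply (⇑(c • f)) ⟨z, hz⟩
    have h2 := extendZero_apply (⇑f) ⟨z, hz⟩
    simp_all

/-- `S_N(f, ζ)(z)`: the value at `z` of the `N`-th partial sum of the Taylor expansion of `f`
with center `ζ`. -/
noncomputable def taylorSum (N : ℕ) (f : ℂ → ℂ) (ζ z : ℂ) : ℂ :=
  ∑ n ∈ Finset.range (N + 1), iteratedDeriv n f ζ / (n.factorial : ℂ) * (z - ζ) ^ n

theorem differentiableOn_taylorSum {U : Set ℂ} (hU : IsOpen U) {f : ℂ → ℂ}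
    (hf : DifferentiableOn ℂ f U) (N : ℕ) (z : ℂ) :
    DifferentiableOn ℂ (fun ζ => taylorSum N f ζ z) U := by
  have hd : ∀ n : ℕ, DifferentiableOn ℂ (iteratedDeriv n f) U := by
    intro n
    induction n with
    | zero => simpa using hf
    | succ n ih => rw [iteratedDeriv_succ]; exact ih.deriv hU
  unfold taylorSum
  refine DifferentiableOn.fun_sum fun n _ => ?_
  exact ((hd n).div_const _).mul (by fun_prop)

/-- The operator `f ↦ (ζ ↦ S_N(f, ζ)(0))` from `H(Ω)` to `H(Ω)`. -/
noncomputable def centerTaylor (Ω : Opens ℂ) (N : ℕ) (f : Holo Ω) : Holo Ω :=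
  ⟨⟨fun ζ : Ω => taylorSum N (extendZero (f : C(Ω, ℂ))) ζ 0,
      continuousOn_iff_continuous_domRestrict.1
        (differentiableOn_taylorSum Ω.isOpen f.2 N 0).continuousOn⟩,
    (differentiableOn_taylorSum Ω.isOpen f.2 N 0).congr fun z hz =>
      extendZero_apply (fun ζ : Ω => taylorSum N (extendZero (f : C(Ω, ℂ))) ζ 0) ⟨z, hz⟩⟩

/-- The class of all `f ∈ H(Ω)` whose orbit `{T_N(f) : N ≥ 0}`, for the operators
`T_N = centerTaylor Ω N`, is dense in `H(Ω)`. -/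
def universalClass (Ω : Opens ℂ) : Set (Holo Ω) :=
  {f | Dense (Set.range fun N : ℕ => centerTaylor Ω N f)}

end TaylorCenter

open Polynomial

namespace TaylorCenter

variable {Ω : Opens ℂ}

/-! Write `E` for the Euler operator and `T_N` for `centerTaylor Ω N`. Differentiating a Taylor sum
in its center telescopes, which gives `T_{N+1} = (1 - E/(N+1)) T_N`. So `T_N` is a polynomial in
`E`: the `T_N` commute, and `T_N` factors through `T_M` for `M ≤ N`. If `f` is universal, the tail
of its orbit from `M` on is still dense and lies in the range of `T_M`, so `T_M` has dense range. By
commutation `T_M` maps the orbit of `f` onto that of `T_M f`, which is therefore dense. Hence the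
whole dense orbit of `f` consists of universal functions. -/

theorem differentiableOn_extendZero (f : Holo Ω) :
    DifferentiableOn ℂ (extendZero (f : C(Ω, ℂ))) Ω := f.2

theorem deriv_extendZero_congr {f : Ω → ℂ} {g : ℂ → ℂ} (h : ∀ z : Ω, f z = g z) (z : Ω) :
    deriv (extendZero f) z = deriv g z := by
  refine Filter.EventuallyEq.deriv_eq ?_
  filter_upwards [Ω.isOpen.mem_nhds z.2] with w hw
  exact (extendZero_apply f ⟨w, hw⟩).trans (h ⟨w, hw⟩)

/-- The Euler operator `f ↦ (z ↦ z f'(z))` on `H(Ω)`. -/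
noncomputable def eulerOp (Ω : Opens ℂ) : Module.End ℂ (Holo Ω) where
  toFun f := ⟨⟨fun z : Ω => z * deriv (extendZero (f : C(Ω, ℂ))) z,
      continuousOn_iff_continuous_domRestrict.1
        (continuousOn_id.mul ((differentiableOn_extendZero f).deriv Ω.isOpen).continuousOn)⟩,
    (differentiableOn_id.mul ((differentiableOn_extendZero f).deriv Ω.isOpen)).congr fun z hz =>
      extendZero_apply (fun z : Ω => (z : ℂ) * deriv (extendZero (f : C(Ω, ℂ))) z) ⟨z, hz⟩⟩
  map_add' f g := by
    ext z
    have hf := (differentiableOn_extendZero f).differentiableAt (Ω.isOpen.mem_nhds z.2)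
    have hg := (differentiableOn_extendZero g).differentiableAt (Ω.isOpen.mem_nhds z.2)
    have h := deriv_extendZero_congr (f := ⇑((f + g : Holo Ω) : C(Ω, ℂ)))
      (g := extendZero (f : C(Ω, ℂ)) + extendZero (g : C(Ω, ℂ)))
      (fun w => by simp [extendZero_apply]) z
    rw [deriv_add hf hg] at h
    change (z : ℂ) * _ = z * _ + z * _
    rw [h, mul_add]
  map_smul' c f := by
    ext z
    have hf := (differentiableOn_extendZero f).differentiableAt (Ω.isOpen.mem_nhds z.2)
    have h := deriv_extendZero_congr (f := ⇑((c • f : Holo Ω) : C(Ω, ℂ)))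
      (g := c • extendZero (f : C(Ω, ℂ))) (fun w => by simp [extendZero_apply]) z
    rw [deriv_const_smul c hf] at h
    change (z : ℂ) * _ = c * (z * _)
    rw [h, smul_eq_mul, mul_left_comm]

/-- Weierstrass: locally uniform convergence of holomorphic functions passes to derivatives. -/
theorem continuous_eulerOp (Ω : Opens ℂ) : Continuous (eulerOp Ω) := by
  have : LocallyCompactSpace Ω := Ω.isOpen.locallyCompactSpace
  let d : Holo Ω → C(Ω, ℂ) := fun f => ⟨fun z : Ω => deriv (extendZero (f : C(Ω, ℂ))) z,
    continuousOn_iff_continuous_domRestrict.1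
      ((differentiableOn_extendZero f).deriv Ω.isOpen).continuousOn⟩
  have hd : Continuous d := by
    refine continuous_iff_continuousAt.2 fun f => ?_
    refine ContinuousMap.tendsto_iff_tendstoLocallyUniformly.2 ?_
    have h := ContinuousMap.tendsto_iff_tendstoLocallyUniformly.1
      (continuous_subtype_val.tendsto f)
    have h' : TendstoLocallyUniformlyOn (fun (g : Holo Ω) => extendZero (g : C(Ω, ℂ)))
        (extendZero (f : C(Ω, ℂ))) (nhds f) (Ω : Set ℂ) := by
      rw [tendstoLocallyUniformlyOn_iff_tendstoLocallyUniformly_comp_coe]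
      have hv (g : Holo Ω) (z : Ω) : extendZero (g : C(Ω, ℂ)) z = (g : C(Ω, ℂ)) z :=
        extendZero_apply _ z
      simp only [Function.comp_def, hv]
      exact h
    have h'' := h'.deriv (Filter.Eventually.of_forall differentiableOn_extendZero) Ω.isOpen
    exact tendstoLocallyUniformlyOn_iff_tendstoLocallyUniformly_comp_coe.1 h''
  let i : C(Ω, ℂ) := ⟨Subtype.val, continuous_subtype_val⟩
  exact Continuous.subtype_mk ((continuous_const (y := i)).mul hd) _

theorem differentiableOn_iteratedDeriv {U : Set ℂ} (hU : IsOpen U) {f : ℂ → ℂ}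
    (hf : DifferentiableOn ℂ f U) (n : ℕ) : DifferentiableOn ℂ (iteratedDeriv n f) U := by
  induction n with
  | zero => simpa using hf
  | succ n ih => rw [iteratedDeriv_succ]; exact ih.deriv hU

theorem taylorSum_succ (N : ℕ) (f : ℂ → ℂ) (ζ z : ℂ) :
    taylorSum (N + 1) f ζ z = taylorSum N f ζ z +
      iteratedDeriv (N + 1) f ζ / ((N + 1).factorial : ℂ) * (z - ζ) ^ (N + 1) :=
  Finset.sum_range_succ _ _

/-- The product rule makes consecutive terms cancel; only the top one survives. -/
theorem hasDerivAt_taylorSum {U : Set ℂ} (hU : IsOpen U) {f : ℂ → ℂ}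
    (hf : DifferentiableOn ℂ f U) (N : ℕ) (z : ℂ) {ζ : ℂ} (hζ : ζ ∈ U) :
    HasDerivAt (fun ζ => taylorSum N f ζ z)
      (iteratedDeriv (N + 1) f ζ / (N.factorial : ℂ) * (z - ζ) ^ N) ζ := by
  have hd (n : ℕ) : HasDerivAt (iteratedDeriv n f) (iteratedDeriv (n + 1) f ζ) ζ := by
    rw [iteratedDeriv_succ]
    exact ((differentiableOn_iteratedDeriv hU hf n).differentiableAt (hU.mem_nhds hζ)).hasDerivAt
  induction N with
  | zero => simpa [taylorSum] using hd 0
  | succ N ih =>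
    simp only [taylorSum_succ]
    refine (ih.add (((hd (N + 1)).div_const ((N + 1).factorial : ℂ)).mul
      (((hasDerivAt_id' ζ).const_sub z).pow (N + 1)))).congr_deriv ?_
    have h1 : (N.factorial : ℂ) ≠ 0 := by exact_mod_cast N.factorial_ne_zero
    have h2 : (N : ℂ) + 1 ≠ 0 := by exact_mod_cast N.succ_ne_zero
    simp only [Nat.factorial_succ, Nat.add_sub_cancel, Pi.pow_apply]
    push_cast
    field_simp
    ring

theorem centerTaylor_apply (N : ℕ) (f : Holo Ω) (z : Ω) :
    (centerTaylor Ω N f : C(Ω, ℂ)) z = taylorSum N (extendZero (f : C(Ω, ℂ))) z 0 := rfl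

theorem centerTaylor_zero (f : Holo Ω) : centerTaylor Ω 0 f = f := by
  ext z
  simp [centerTaylor_apply, taylorSum, extendZero_apply]

theorem centerTaylor_succ (N : ℕ) (f : Holo Ω) :
    centerTaylor Ω (N + 1) f =
      centerTaylor Ω N f + (-((N : ℂ) + 1)⁻¹) • eulerOp Ω (centerTaylor Ω N f) := by
  ext z
  have h : deriv (extendZero (centerTaylor Ω N f : C(Ω, ℂ))) z = _ :=
    (deriv_extendZero_congr (fun w => centerTaylor_apply N f w) z).trans
      (hasDerivAt_taylorSum Ω.isOpen (differentiableOn_extendZero f) N 0 z.2).deriv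
  change taylorSum (N + 1) (extendZero (f : C(Ω, ℂ))) z 0 =
    taylorSum N (extendZero (f : C(Ω, ℂ))) z 0 + (-((N : ℂ) + 1)⁻¹) * (z * _)
  rw [h, taylorSum_succ, Nat.factorial_succ]
  have h1 : (N.factorial : ℂ) ≠ 0 := by exact_mod_cast N.factorial_ne_zero
  have h2 : (N : ℂ) + 1 ≠ 0 := by exact_mod_cast N.succ_ne_zero
  push_cast
  field_simp
  ring

/-- The polynomial `∏_{k < N} (1 - X / (k + 1))`, whose value at the Euler operator is
`centerTaylor Ω N`. -/
noncomputable def eulerPoly (N : ℕ) : ℂ[X] :=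
  ∏ k ∈ Finset.range N, (1 + C (-((k : ℂ) + 1)⁻¹) * X)

theorem eulerPoly_dvd {M N : ℕ} (h : M ≤ N) : eulerPoly M ∣ eulerPoly N :=
  Finset.prod_dvd_prod_of_subset _ _ _ (Finset.range_mono h)

theorem centerTaylor_eq_aeval (N : ℕ) (f : Holo Ω) :
    centerTaylor Ω N f = aeval (eulerOp Ω) (eulerPoly N) f := by
  induction N with
  | zero => simp [eulerPoly, centerTaylor_zero]
  | succ N ih =>
    have h : eulerPoly (N + 1) = (1 + C (-((N : ℂ) + 1)⁻¹) * X) * eulerPoly N :=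
      (Finset.prod_range_succ _ _).trans (mul_comm _ _)
    rw [centerTaylor_succ, ih, h, map_mul,
      map_add, map_one, map_mul, aeval_C, aeval_X, Module.End.mul_apply, LinearMap.add_apply,
      Module.End.mul_apply, Module.algebraMap_end_apply, Module.End.one_apply]

theorem continuous_centerTaylor (N : ℕ) : Continuous (centerTaylor Ω N) := by
  induction N with
  | zero => exact continuous_id.congr fun f => (centerTaylor_zero f).symm
  | succ N ih =>
    refine Continuous.congr ?_ fun f => (centerTaylor_succ N f).symm
    exact ((continuous_subtype_val.comp ih).add ((continuous_subtype_val.comp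
      ((continuous_eulerOp Ω).comp ih)).const_smul (-((N : ℂ) + 1)⁻¹))).subtype_mk _

theorem centerTaylor_comm (M N : ℕ) (f : Holo Ω) :
    centerTaylor Ω M (centerTaylor Ω N f) = centerTaylor Ω N (centerTaylor Ω M f) := by
  simp only [centerTaylor_eq_aeval, ← Module.End.mul_apply, ← map_mul, mul_comm]

theorem centerTaylor_mem_range {M N : ℕ} (h : M ≤ N) (f : Holo Ω) :
    centerTaylor Ω N f ∈ Set.range (centerTaylor Ω M) := by
  obtain ⟨q, hq⟩ := eulerPoly_dvd h
  refine ⟨aeval (eulerOp Ω) q f, ?_⟩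
  rw [centerTaylor_eq_aeval, centerTaylor_eq_aeval, hq, map_mul, Module.End.mul_apply]

theorem nontrivial_holo (hΩ : (Ω : Set ℂ).Nonempty) : Nontrivial (Holo Ω) := by
  obtain ⟨z, hz⟩ := hΩ
  have h1 : (1 : C(Ω, ℂ)) ∈ Holo Ω := (differentiableOn_const (1 : ℂ)).congr fun z hz =>
    extendZero_apply (⇑(1 : C(Ω, ℂ))) ⟨z, hz⟩
  refine ⟨⟨⟨1, h1⟩, 0, fun h => one_ne_zero (α := ℂ) ?_⟩⟩
  exact congrArg (fun f : Holo Ω => (f : C(Ω, ℂ)) ⟨z, hz⟩) h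

theorem denseRange_centerTaylor (hΩ : (Ω : Set ℂ).Nonempty) {f : Holo Ω}
    (hf : f ∈ universalClass Ω) (M : ℕ) : DenseRange (centerTaylor Ω M) := by
  have := nontrivial_holo hΩ
  -- No point is isolated, so deleting the finitely many `T_N f` with `N < M` keeps the orbit dense.
  have (g : Holo Ω) : (nhdsWithin g {g}ᶜ).NeBot := Module.punctured_nhds_neBot ℂ (Holo Ω) g
  have hd : Dense _ := Dense.sdiff_finite hf
    ((Set.finite_lt_nat M).image fun N => centerTaylor Ω N f)
  refine hd.mono ?_
  rintro _ ⟨⟨N, rfl⟩, hN⟩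
  exact centerTaylor_mem_range (not_lt.1 fun h => hN ⟨N, h, rfl⟩) f

theorem centerTaylor_mem_universalClass (hΩ : (Ω : Set ℂ).Nonempty) {f : Holo Ω}
    (hf : f ∈ universalClass Ω) (M : ℕ) : centerTaylor Ω M f ∈ universalClass Ω := by
  have h := (denseRange_centerTaylor hΩ hf M).dense_image (continuous_centerTaylor M) hf
  rw [← Set.range_comp] at h
  simpa only [universalClass, Set.mem_ofPred_eq, Function.comp_def, centerTaylor_comm M] using h

/-- Density need only be tested on a countable basis, and each test is an open condition on `f`. -/
theorem isGδ_universalClass (Ω : Opens ℂ) : IsGδ (universalClass Ω) := by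
  have : LocallyCompactSpace Ω := Ω.isOpen.locallyCompactSpace
  have : SecondCountableTopology (Holo Ω) :=
    Subtype.secondCountableTopology _
  have hB := isBasis_countableBasis (Holo Ω)
  have h : universalClass Ω = ⋂ U ∈ {U ∈ countableBasis (Holo Ω) | U.Nonempty},
      ⋃ N : ℕ, centerTaylor Ω N ⁻¹' U := by
    ext f
    simp only [universalClass, Set.mem_ofPred_eq, hB.dense_iff, Set.mem_iInter, Set.mem_iUnion,
      Set.mem_preimage, Set.inter_nonempty, Set.mem_range, and_imp]
    exact forall₃_congr fun U _ _ =>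
      ⟨fun ⟨_, hU, N, hN⟩ => ⟨N, hN ▸ hU⟩, fun ⟨N, hN⟩ => ⟨_, hN, N, rfl⟩⟩
  rw [h]
  refine IsGδ.biInter ((countable_countableBasis _).mono fun U hU => hU.1) fun U hU => ?_
  exact (isOpen_iUnion fun N =>
    (hB.isOpen hU.1).preimage (continuous_centerTaylor N)).isGδ

end TaylorCenter

theorem mainTheorem3 (Ω : TopologicalSpace.Opens ℂ) (hΩ : IsSimplyConnected (Ω : Set ℂ)) :
    TaylorCenter.universalClass Ω = ∅ ∨
      (Dense (TaylorCenter.universalClass Ω) ∧ IsGδ (TaylorCenter.universalClass Ω)) := by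
  refine (Set.eq_empty_or_nonempty _).imp_right fun ⟨f, hf⟩ =>
    ⟨Dense.mono ?_ hf, TaylorCenter.isGδ_universalClass Ω⟩
  -- The dense subset is the orbit of `f` itself.
  rintro _ ⟨M, rfl⟩
  exact TaylorCenter.centerTaylor_mem_universalClass hΩ.nonempty hf M
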